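/- For $1\le k\le p$ let $\Theta[k,p]\subset\mathbb{R}^p$ be the set of vectors with at most $k$ non-zero components. For a fixed design matrix $\mathbf{X}\in\mathbb{R}^{n\times p}$, $\theta_0\in\mathbb{R}^p$ and $\sigma>0$, let $\mathbb{E}_{\theta_0,\sigma}$ be the expectation when $\mathbf{Y}=\mathbf{X}\theta_0+\boldsymbol{\epsilon}$ with $\boldsymbol{\epsilon}\sim\mathcal{N}(0_n,\sigma^2I_n)$. There exist universal constants $C,C_1,C_2>0$ such that the following holds. For all integers $p\ge n\ge C$ and all integers $k$ with $1\le k\le p^{1/3}$, there exists a design $\mathbf{X}\in\mathbb{R}^{n\times p}$ such that $$\inf_{\widehat{\sigma}}\ \sup_{\sigma>0,\ \theta_0\in\Theta[k,p]}\ \mathbb{E}_{\theta_0,\sigma}\left[\left|\frac{\widehat{\sigma}^2}{\sigma^2}-\frac{\sigma^2}{\widehat{\sigma}^2}\right|\right]\ \ge\ C_1\frac{k}{n}\log\left(\frac{p}{k}\right)\exp\left[C_2\frac{k}{n}\log\left(\frac{p}{k}\right)\right],$$ where the infimum is over all estimators $\widehat{\sigma}=\widehat{\sigma}(\mathbf{Y})$,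 that is, all measurable functions from $\mathbb{R}^n$ to $[0,\infty)$ (the function may depend on $\mathbf{X}$, $k$, $n$, $p$), the loss is $+\infty$ where $\widehat{\sigma}=0$, and the risk may be infinite. -/

import Mathlib

open scoped ENNReal NNReal

noncomputable section

namespace SparseRegression

/-- The set of vectors of `ℝ^p` with at most `k` non-zero components. -/
def sparseVectors (k p : ℕ) : Set (Fin p → ℝ) :=
  {θ | (Function.support θ).ncard ≤ k}

/-- The law of the response `Y = X θ + ε`, where `ε` has independent `N(0, σ²)` components:
the normal law `N(X θ, σ² I_n)` on `ℝ^n`. -/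
def responseLaw {n p : ℕ} (X : Matrix (Fin n) (Fin p) ℝ) (θ : Fin p → ℝ) (σ : ℝ) :
    MeasureTheory.Measure (Fin n → ℝ) :=
  MeasureTheory.Measure.pi fun i =>
    ProbabilityTheory.gaussianReal (X.mulVec θ i) (Real.toNNReal (σ ^ 2))

/-- The loss `|s² / σ² - σ² / s²|` of the estimate `s ≥ 0` of `σ > 0`; it is infinite at
`s = 0`, where the second ratio is. -/
def varianceLoss (s : ℝ≥0) (σ : ℝ) : ℝ≥0∞ :=
  if s = 0 then ⊤ else ENNReal.ofReal |(s : ℝ) ^ 2 / σ ^ 2 - σ ^ 2 / (s : ℝ) ^ 2|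

/-- The expected loss of the estimator `σhat` under the parameters `θ` and `σ`. -/
def varianceRisk {n p : ℕ} (X : Matrix (Fin n) (Fin p) ℝ) (σhat : (Fin n → ℝ) → ℝ≥0)
    (θ : Fin p → ℝ) (σ : ℝ) : ℝ≥0∞ :=
  ∫⁻ y, varianceLoss (σhat y) σ ∂(responseLaw X θ σ)

/-- The minimax risk of variance estimation over `k`-sparse vectors and all `σ > 0`,
for the fixed design `X`. The infimum is over all (measurable) estimators. -/
def minimaxVarianceRisk {n p : ℕ} (k : ℕ) (X : Matrix (Fin n) (Fin p) ℝ) : ℝ≥0∞ :=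
  ⨅ (σhat : (Fin n → ℝ) → ℝ≥0) (_ : Measurable σhat),
    ⨆ (σ : ℝ) (_ : 0 < σ) (θ : Fin p → ℝ) (_ : θ ∈ sparseVectors k p),
      varianceRisk X σhat θ σ

end SparseRegression

end

namespace SparseRegression
open MeasureTheory ProbabilityTheory Real

/-! Le Cam's method: pure noise of variance `R = r ^ 2` is confused with noise of variance one plus
a random sparse signal. Under the null, `θ = 0` and `Y` has law `N(0, R I)` for every design. Under
the alternative, `θ` is the indicator of a random `k`-set. If the design has independent `N(0, (R -
1) / k)` entries, then averaging over the design turns each alternative into the null.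

The design must nevertheless be fixed, so the second moment of the mixture likelihood ratio is
averaged over designs. A pair of supports sharing `m` indices contributes `(R / (1 + (1 - m / k) *
(R - 1))) ^ n`, at most `R ^ (n * m / k)`, which is `a ^ m` when `R ^ n = a ^ k`. Choosing one index
in each of `k` blocks of size `q` makes the average over pairs factor into `((a + q - 1) / q) ^ k ≤
exp (k * a / q)` (`exists_design`).

With `a = (p / k) ^ (1 / 6)` and `k ≤ p ^ (1 / 3)` this is at most 2, so some design attains this
bound. No estimator then separates the hypotheses, and the loss is at least of order `r - 1 / r`
(`le_minimaxVarianceRisk`). Since `log r` is proportional to `(k / n) * log (p / k)`, the stated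
rate follows. -/

/-! ### One-dimensional Gaussian integrals. -/

lemma measurable_gaussianPDF_comp {α : Type*} [MeasurableSpace α] {f g : α → ℝ}
    (hf : Measurable f) (V : ℝ≥0) (hg : Measurable g) :
    Measurable fun a ↦ gaussianPDF (f a) V (g a) :=
  measurable_uncurry_gaussianPDF.comp (hf.prodMk (measurable_const.prodMk hg))

/-- Averaging a normal density over a normal location gives a normal density. -/
lemma lintegral_gaussianPDF_gaussianReal (w : ℝ) {V : ℝ≥0} (hV : V ≠ 0) (s : ℝ≥0) (y : ℝ) :
    ∫⁻ v, gaussianPDF (w + v) V y ∂(gaussianReal 0 s) = gaussianPDF w (V + s) y := by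
  rcases eq_or_ne s 0 with rfl | hs
  · rw [gaussianReal_zero_var, lintegral_dirac']
    · simp
    · exact measurable_gaussianPDF_comp (by fun_prop) V measurable_const
  have hV0 : (0 : ℝ) < V := by positivity
  have hs0 : (0 : ℝ) < s := by positivity
  have hQ : V * s / (V + s) ≠ 0 := by positivity
  have hm : Measurable fun v ↦ gaussianPDF (w + v) V y :=
    measurable_gaussianPDF_comp (by fun_prop) V measurable_const
  rw [gaussianReal_of_var_ne_zero _ hs, lintegral_withDensity_eq_lintegral_mul _
    (measurable_gaussianPDF _ _) hm]
  -- Completing the square: marginal density of `y` times posterior density of `v` given `y`.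
  have key : ∀ v : ℝ, (gaussianPDF 0 s * fun v ↦ gaussianPDF (w + v) V y) v =
      gaussianPDF w (V + s) y * gaussianPDF ((y - w) * s / (V + s)) (V * s / (V + s)) v := by
    intro v
    simp only [Pi.mul_apply, gaussianPDF]
    rw [← ENNReal.ofReal_mul (gaussianPDFReal_nonneg _ _ _),
      ← ENNReal.ofReal_mul (gaussianPDFReal_nonneg _ _ _)]
    congr 1
    simp only [gaussianPDFReal]
    rw [mul_mul_mul_comm, mul_mul_mul_comm (√(2 * π * ((V + s : ℝ≥0) : ℝ)))⁻¹,
      ← Real.exp_add, ← Real.exp_add]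
    congr 1
    · rw [← mul_inv, ← mul_inv, ← Real.sqrt_mul (by positivity), ← Real.sqrt_mul (by positivity)]
      congr 2
      push_cast
      field_simp
    · congr 1
      push_cast
      field_simp
      ring
  simp_rw [key]
  rw [lintegral_const_mul _ (measurable_gaussianPDF _ _), lintegral_gaussianPDF_eq_one _ hQ, mul_one]

lemma gaussianPDF_sq (w : ℝ) {V : ℝ≥0} (hV : V ≠ 0) (y : ℝ) :
    gaussianPDF w V y ^ 2 = ENNReal.ofReal (2 * √(π * V))⁻¹ * gaussianPDF w (V / 2) y := by
  have hV0 : (0 : ℝ) < V := by positivity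
  simp only [gaussianPDF]
  rw [← ENNReal.ofReal_pow (gaussianPDFReal_nonneg _ _ _), ← ENNReal.ofReal_mul (by positivity)]
  congr 1
  simp only [gaussianPDFReal]
  rw [mul_pow, ← Real.exp_nat_mul, ← mul_assoc]
  congr 1
  · rw [inv_pow, Real.sq_sqrt (by positivity), ← mul_inv]
    congr 1
    push_cast
    rw [show 2 * π * ((V : ℝ) / 2) = π * V by ring, mul_assoc 2 √(π * V),
      Real.mul_self_sqrt (by positivity)]
    ring
  · congr 1
    push_cast
    field_simp

/-- The chi-square integral of a normal location mixture `N(w, V)`, `w ∼ N(0, s)`,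
with respect to its marginal `N(0, V + s)`. -/
lemma lintegral_gaussianPDF_sq_div {V : ℝ≥0} (hV : V ≠ 0) (s : ℝ≥0) :
    ∫⁻ y, (∫⁻ w, gaussianPDF w V y ^ 2 ∂(gaussianReal 0 s)) / gaussianPDF 0 (V + s) y =
      ENNReal.ofReal ((V + s) / V) := by
  have hV0 : (0 : ℝ) < V := by positivity
  have hR : V + s ≠ 0 := by positivity
  have hV2 : V / 2 ≠ 0 := by positivity
  have hQ : 2 * (V + s) * (V / 2 + s) / V ≠ 0 := by positivity
  -- Averaging the squared density leaves a multiple of `N(0, V / 2 + s)`. Dividing by `N(0, V + s)`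
  -- subtracts precisions: the inverse of `1 / (V / 2 + s) - 1 / (V + s)` is the variance below.
  have key : ∀ y : ℝ, (∫⁻ w, gaussianPDF w V y ^ 2 ∂(gaussianReal 0 s)) / gaussianPDF 0 (V + s) y =
      ENNReal.ofReal ((V + s) / V) * gaussianPDF 0 (2 * (V + s) * (V / 2 + s) / V) y := by
    intro y
    have hm : Measurable fun w ↦ gaussianPDF w (V / 2) y :=
      measurable_gaussianPDF_comp measurable_id _ measurable_const
    simp_rw [gaussianPDF_sq _ hV]
    rw [lintegral_const_mul _ hm]
    have h := lintegral_gaussianPDF_gaussianReal 0 hV2 s y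
    simp only [zero_add] at h
    rw [h]
    simp only [gaussianPDF]
    rw [← ENNReal.ofReal_mul (by positivity), ← ENNReal.ofReal_mul (by positivity),
      ← ENNReal.ofReal_div_of_pos (gaussianPDFReal_pos _ _ _ hR)]
    congr 1
    simp only [gaussianPDFReal]
    have e : ∀ a b c d e : ℝ, a * (b * c) / (d⁻¹ * e) = (a * b * d) * (c / e) := by
      intro a b c d e
      rw [div_eq_mul_inv, mul_inv, inv_inv, div_eq_mul_inv]; ring
    rw [e, ← Real.exp_sub, ← mul_assoc]
    congr 1
    · rw [← Real.sqrt_sq (show 0 ≤ ((V : ℝ) + s) / V by positivity), ← Real.sqrt_inv,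
        ← Real.sqrt_inv, show (2 * √(π * V))⁻¹ = √((4 * (π * V))⁻¹) by
          rw [Real.sqrt_inv, Real.sqrt_mul (show (0 : ℝ) ≤ 4 by norm_num) (π * V),
            show (4 : ℝ) = 2 ^ 2 by norm_num, Real.sqrt_sq (by norm_num)],
        ← Real.sqrt_mul (by positivity), ← Real.sqrt_mul (by positivity),
        ← Real.sqrt_mul (by positivity)]
      congr 1
      push_cast
      field_simp
      ring
    · congr 1
      push_cast
      field_simp
      ring
  simp_rw [key]
  rw [lintegral_const_mul _ (measurable_gaussianPDF _ _), lintegral_gaussianPDF_eq_one _ hQ, mul_one]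

/-! ### Independence, and Gaussian sums over overlapping index sets. -/

lemma lintegral_of_indepFun {Ω α β : Type*} [MeasurableSpace Ω] [MeasurableSpace α]
    [MeasurableSpace β] {μ : Measure Ω} [IsProbabilityMeasure μ] {Z : Ω → α} {T : Ω → β}
    (h : IndepFun Z T μ) (hZ : Measurable Z) (hT : Measurable T) {F : α × β → ℝ≥0∞}
    (hF : Measurable F) :
    ∫⁻ ω, F (Z ω, T ω) ∂μ = ∫⁻ ω, ∫⁻ t, F (Z ω, t) ∂(μ.map T) ∂μ := by
  have := Measure.isProbabilityMeasure_map (μ := μ) hT.aemeasurable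
  rw [← lintegral_map (f := F) hF (hZ.prodMk hT),
    (indepFun_iff_map_prod_eq_prod_map_map hZ.aemeasurable hT.aemeasurable).1 h,
    lintegral_prod _ hF.aemeasurable, lintegral_map hF.lintegral_prod_right' hZ]

lemma lintegral_pi_prod_eq {ι α : Type*} [Fintype ι] [MeasurableSpace α]
    (μ : ι → Measure α) [∀ i, IsProbabilityMeasure (μ i)] {f : ι → α → ℝ≥0∞}
    (hf : ∀ i, Measurable (f i)) :
    ∫⁻ x, ∏ i, f i (x i) ∂(Measure.pi μ) = ∏ i, ∫⁻ a, f i a ∂(μ i) := by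
  have h := iIndepFun_pi (μ := μ) (X := f) (fun i ↦ (hf i).aemeasurable)
  rw [lintegral_prod_eq_prod_lintegral_of_indepFun Finset.univ _ h
    (fun i ↦ (hf i).comp (measurable_pi_apply i))]
  refine Finset.prod_congr rfl fun i _ ↦ ?_
  rw [← (measurePreserving_eval μ i).lintegral_comp (hf i)]

section IndexedSums

variable {ι : Type*} [Fintype ι] [DecidableEq ι]

lemma indepFun_sum_sum (μ : ι → Measure ℝ) [∀ i, IsProbabilityMeasure (μ i)]
    {A B C : Finset ι} (h : Disjoint (A ∪ B) C) :
    IndepFun (fun x : ι → ℝ ↦ (∑ j ∈ A, x j, ∑ j ∈ B, x j)) (fun x ↦ ∑ j ∈ C, x j)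
      (Measure.pi μ) := by
  have h0 : iIndepFun (fun (i : ι) (x : ι → ℝ) ↦ x i) (Measure.pi μ) :=
    iIndepFun_pi (X := fun _ ↦ id) (fun i ↦ aemeasurable_id)
  have h1 := h0.indepFun_finset (A ∪ B) C h (fun i ↦ measurable_pi_apply i)
  have e : ∀ S D : Finset ι, S ⊆ D → ∀ x : ι → ℝ, ∑ j ∈ S, x j =
      ∑ j : D, if (j : ι) ∈ S then x j else 0 := by
    intro S D hSD x
    rw [Finset.sum_coe_sort D (fun j ↦ if j ∈ S then x j else 0), Finset.sum_ite_mem,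
      Finset.inter_eq_right.2 hSD]
  have hd : ∀ D E : Finset ι, Measurable fun z : D → ℝ ↦
      ∑ j : D, if (j : ι) ∈ E then z j else 0 := fun D E ↦
    Finset.measurable_sum _ fun j _ ↦ by split_ifs <;> fun_prop
  have h2 := h1.comp ((hd (A ∪ B) A).prodMk (hd (A ∪ B) B)) (hd C C)
  convert! h2 using 1
  · ext x
    · exact e A _ Finset.subset_union_left x
    · exact e B _ Finset.subset_union_right x
  · ext x
    exact e C C subset_rfl x

lemma indepFun_sum (μ : ι → Measure ℝ) [∀ i, IsProbabilityMeasure (μ i)]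
    {A C : Finset ι} (h : Disjoint A C) :
    IndepFun (fun x : ι → ℝ ↦ ∑ j ∈ A, x j) (fun x ↦ ∑ j ∈ C, x j) (Measure.pi μ) :=
  (indepFun_sum_sum μ (A := A) (B := A) (by simpa using h)).comp (φ := Prod.fst)
    measurable_fst measurable_id

lemma map_sum_gaussianReal (s : ℝ≥0) (S : Finset ι) :
    (Measure.pi fun _ : ι ↦ gaussianReal 0 s).map (fun x ↦ ∑ j ∈ S, x j) =
      gaussianReal 0 (S.card * s) := by
  induction S using Finset.induction_on with
  | empty => simp [Measure.map_const]
  | insert a S ha ih =>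
    have h := gaussianReal_add_gaussianReal_of_indepFun
      (indepFun_sum (fun _ : ι ↦ gaussianReal 0 s) (A := {a}) (C := S) (by simpa using ha))
      (m₁ := 0) (v₁ := s) (by
        simpa using (measurePreserving_eval (fun _ : ι ↦ gaussianReal 0 s) a).map_eq) ih
    have e : (fun x : ι → ℝ ↦ ∑ j ∈ insert a S, x j) =
        (fun x ↦ ∑ j ∈ {a}, x j) + fun x ↦ ∑ j ∈ S, x j := by
      ext x; simp [Finset.sum_insert ha]
    rw [e, h, Finset.card_insert_of_notMem ha]
    congr 1
    · simp
    · push_cast; ring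

/-- Two sums of independent normal variables over overlapping index sets: their joint effect on a
unit normal density only depends on the size of the overlap. -/
lemma lintegral_gaussianPDF_sum_mul_sum (s : ℝ≥0) {S T : Finset ι} (hST : S.card = T.card)
    (y : ℝ) :
    ∫⁻ x, gaussianPDF (∑ j ∈ S, x j) 1 y * gaussianPDF (∑ j ∈ T, x j) 1 y
        ∂(Measure.pi fun _ : ι ↦ gaussianReal 0 s) =
      ∫⁻ w, gaussianPDF w (1 + (S \ T).card * s) y ^ 2
        ∂(gaussianReal 0 ((S ∩ T).card * s)) := by
  set μ := Measure.pi fun _ : ι ↦ gaussianReal 0 s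
  have hcard : (T \ S).card = (S \ T).card := by
    have h1 := Finset.card_sdiff_add_card_inter S T
    have h2 := Finset.card_sdiff_add_card_inter T S
    rw [Finset.inter_comm] at h2
    omega
  have hsum : ∀ D : Finset ι, Measurable fun x : ι → ℝ ↦ ∑ j ∈ D, x j := fun D ↦
    Finset.measurable_sum _ fun j _ ↦ measurable_pi_apply j
  have eS : ∀ x : ι → ℝ, ∑ j ∈ S, x j = ∑ j ∈ S ∩ T, x j + ∑ j ∈ S \ T, x j := fun x ↦
    (Finset.sum_inter_add_sum_sdiff S T x).symm
  have eT : ∀ x : ι → ℝ, ∑ j ∈ T, x j = ∑ j ∈ S ∩ T, x j + ∑ j ∈ T \ S, x j := fun x ↦ by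
    rw [Finset.inter_comm]; exact (Finset.sum_inter_add_sum_sdiff T S x).symm
  simp_rw [eS, eT]
  -- The private parts `T \ S` and `S \ T` are integrated out in turn, with the common part frozen;
  -- each adds the same variance to one density.
  have i1 := indepFun_sum_sum (fun _ : ι ↦ gaussianReal 0 s) (A := S ∩ T) (B := S \ T)
    (C := T \ S) (by
      rw [Finset.disjoint_left]; intro a; simp only [Finset.mem_union, Finset.mem_inter,
        Finset.mem_sdiff]; tauto)
  have i2 := indepFun_sum (fun _ : ι ↦ gaussianReal 0 s) (A := S ∩ T) (C := S \ T) (by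
      rw [Finset.disjoint_left]; intro a; simp only [Finset.mem_inter, Finset.mem_sdiff]; tauto)
  have step1 := lintegral_of_indepFun i1 ((hsum _).prodMk (hsum _)) (hsum _)
    (F := fun z ↦ gaussianPDF (z.1.1 + z.1.2) 1 y * gaussianPDF (z.1.1 + z.2) 1 y)
    ((measurable_gaussianPDF_comp (by fun_prop) 1 measurable_const).mul
      (measurable_gaussianPDF_comp (by fun_prop) 1 measurable_const))
  have step2 := lintegral_of_indepFun i2 (hsum _) (hsum _)
    (F := fun z ↦ gaussianPDF (z.1 + z.2) 1 y * gaussianPDF z.1 (1 + (S \ T).card * s) y)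
    ((measurable_gaussianPDF_comp (by fun_prop) 1 measurable_const).mul
      (measurable_gaussianPDF_comp (by fun_prop) _ measurable_const))
  simp only at step1 step2
  rw [step1]
  have hm : ∀ w : ℝ, Measurable fun t ↦ gaussianPDF (w + t) 1 y := fun w ↦
    measurable_gaussianPDF_comp (by fun_prop) 1 measurable_const
  simp_rw [lintegral_const_mul _ (hm _), map_sum_gaussianReal,
    lintegral_gaussianPDF_gaussianReal _ one_ne_zero, hcard]
  rw [step2]
  simp_rw [lintegral_mul_const _ (hm _), map_sum_gaussianReal,
    lintegral_gaussianPDF_gaussianReal _ one_ne_zero]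
  have hm2 : Measurable fun w ↦ gaussianPDF w (1 + (S \ T).card * s) y ^ 2 :=
    (measurable_gaussianPDF_comp measurable_id _ measurable_const).pow_const 2
  rw [← map_sum_gaussianReal (ι := ι) s (S ∩ T), lintegral_map hm2 (hsum _)]
  simp_rw [pow_two]

/-- The likelihood ratio of `N(u, 1)` with respect to `N(0, R)`. -/
noncomputable def gaussianRatio (R : ℝ≥0) (u y : ℝ) : ℝ≥0∞ :=
  gaussianPDF u 1 y / gaussianPDF 0 R y

lemma measurable_gaussianRatio_comp {α : Type*} [MeasurableSpace α] (R : ℝ≥0) {f g : α → ℝ}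
    (hf : Measurable f) (hg : Measurable g) : Measurable fun a ↦ gaussianRatio R (f a) (g a) :=
  (measurable_gaussianPDF_comp hf 1 hg).div (measurable_gaussianPDF_comp measurable_const R hg)

/-- After swapping the integrals, only the common sum over `S ∩ T` remains as a random location, and
`lintegral_gaussianPDF_sq_div` applies with `V = 1 + |S \ T| * s`. -/
lemma lintegral_gaussianRatio_mul (s : ℝ≥0) {S T : Finset ι} (hST : S.card = T.card) :
    ∫⁻ x, ∫⁻ y, gaussianRatio (1 + S.card * s) (∑ j ∈ S, x j) y *
        gaussianRatio (1 + S.card * s) (∑ j ∈ T, x j) y ∂(gaussianReal 0 (1 + S.card * s))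
        ∂(Measure.pi fun _ : ι ↦ gaussianReal 0 s) =
      ENNReal.ofReal ((1 + S.card * s) / (1 + (S \ T).card * s)) := by
  set R : ℝ≥0 := 1 + S.card * s with hR
  have hR0 : R ≠ 0 := by positivity
  have hsum : ∀ D : Finset ι, Measurable fun x : ι → ℝ ↦ ∑ j ∈ D, x j := fun D ↦
    Finset.measurable_sum _ fun j _ ↦ measurable_pi_apply j
  have hsplit : R = 1 + (S \ T).card * s + (S ∩ T).card * s := by
    rw [hR, ← Finset.card_sdiff_add_card_inter S T]; push_cast; ring
  have e : ∀ x : ι → ℝ, ∫⁻ y, gaussianRatio R (∑ j ∈ S, x j) y *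
        gaussianRatio R (∑ j ∈ T, x j) y ∂(gaussianReal 0 R) =
      ∫⁻ y, gaussianPDF (∑ j ∈ S, x j) 1 y * gaussianPDF (∑ j ∈ T, x j) 1 y /
        gaussianPDF 0 R y := by
    intro x
    have hmr : ∀ u v : ℝ, Measurable fun y ↦ gaussianRatio R u y * gaussianRatio R v y :=
      fun u v ↦ (measurable_gaussianRatio_comp R measurable_const measurable_id).mul
        (measurable_gaussianRatio_comp R measurable_const measurable_id)
    rw [gaussianReal_of_var_ne_zero _ hR0, lintegral_withDensity_eq_lintegral_mul _
      (measurable_gaussianPDF _ _) (hmr _ _)]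
    refine lintegral_congr fun y ↦ ?_
    have h0 := (gaussianPDF_pos 0 hR0 y).ne'
    have h1 := gaussianPDF_ne_top (μ := 0) (v := R) (x := y)
    simp only [Pi.mul_apply, gaussianRatio, div_eq_mul_inv]
    calc _ = gaussianPDF (∑ j ∈ S, x j) 1 y * gaussianPDF (∑ j ∈ T, x j) 1 y *
        (gaussianPDF 0 R y)⁻¹ * (gaussianPDF 0 R y * (gaussianPDF 0 R y)⁻¹) := by ring
      _ = _ := by rw [ENNReal.mul_inv_cancel h0 h1, mul_one]
  simp_rw [e]
  have hSm : ∀ D : Finset ι, Measurable fun z : (ι → ℝ) × ℝ ↦ gaussianPDF (∑ j ∈ D, z.1 j) 1 z.2 :=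
    fun D ↦ measurable_gaussianPDF_comp ((hsum D).comp measurable_fst) 1 measurable_snd
  rw [lintegral_lintegral_swap (((hSm S).mul (hSm T)).div
    ((measurable_gaussianPDF 0 R).comp measurable_snd)).aemeasurable]
  have hm : ∀ y : ℝ, Measurable fun x : ι → ℝ ↦
      gaussianPDF (∑ j ∈ S, x j) 1 y * gaussianPDF (∑ j ∈ T, x j) 1 y := fun y ↦
    (measurable_gaussianPDF_comp (hsum S) 1 measurable_const).mul
      (measurable_gaussianPDF_comp (hsum T) 1 measurable_const)
  have hi : ∀ y : ℝ, ∫⁻ x, gaussianPDF (∑ j ∈ S, x j) 1 y * gaussianPDF (∑ j ∈ T, x j) 1 y /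
      gaussianPDF 0 R y ∂(Measure.pi fun _ : ι ↦ gaussianReal 0 s) =
      (∫⁻ w, gaussianPDF w (1 + (S \ T).card * s) y ^ 2
        ∂(gaussianReal 0 ((S ∩ T).card * s))) / gaussianPDF 0 R y := by
    intro y
    rw [← lintegral_gaussianPDF_sum_mul_sum s hST, div_eq_mul_inv,
      ← lintegral_mul_const _ (hm y)]
    rfl
  simp_rw [hi]
  have := lintegral_gaussianPDF_sq_div (V := 1 + (S \ T).card * s) (by positivity)
    ((S ∩ T).card * s)
  rw [← hsplit] at this
  rw [this]
  congr 1
  have h2 := congrArg (NNReal.toReal) hsplit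
  have h3 := congrArg (NNReal.toReal) hR
  push_cast at h2 h3 ⊢
  rw [← h2, ← h3]

end IndexedSums

/-! ### Likelihood ratios of sparse regressions and of their mixtures. -/

lemma pi_withDensity_prod {ι α : Type*} [Fintype ι] [MeasurableSpace α]
    (μ : ι → Measure α) [∀ i, IsProbabilityMeasure (μ i)] {f : ι → α → ℝ≥0∞}
    (hf : ∀ i, Measurable (f i)) [∀ i, SigmaFinite ((μ i).withDensity (f i))] :
    Measure.pi (fun i ↦ (μ i).withDensity (f i)) =
      (Measure.pi μ).withDensity fun x ↦ ∏ i, f i (x i) := by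
  refine Measure.pi_eq fun s hs ↦ ?_
  rw [withDensity_apply _ (MeasurableSet.univ_pi hs),
    ← lintegral_indicator (MeasurableSet.univ_pi hs)]
  have e : ∀ x : ι → α, (Set.univ.pi s).indicator (fun x ↦ ∏ i, f i (x i)) x =
      ∏ i, (s i).indicator (f i) (x i) := by
    intro x
    by_cases hx : x ∈ Set.univ.pi s
    · rw [Set.indicator_of_mem hx]
      exact Finset.prod_congr rfl fun i _ ↦ (Set.indicator_of_mem (hx i trivial) _).symm
    · rw [Set.indicator_of_notMem hx]
      obtain ⟨i, hi⟩ : ∃ i, x i ∉ s i := by simpa [Set.mem_pi] using hx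
      exact (Finset.prod_eq_zero (Finset.mem_univ i) (Set.indicator_of_notMem hi _)).symm
  simp_rw [e]
  rw [lintegral_pi_prod_eq μ fun i ↦ (hf i).indicator (hs i)]
  refine Finset.prod_congr rfl fun i _ ↦ ?_
  rw [lintegral_indicator (hs i), withDensity_apply _ (hs i)]

lemma gaussianReal_withDensity_gaussianRatio {R : ℝ≥0} (hR : R ≠ 0) (u : ℝ) :
    (gaussianReal 0 R).withDensity (gaussianRatio R u) = gaussianReal u 1 := by
  have hm : Measurable (gaussianRatio R u) :=
    measurable_gaussianRatio_comp R measurable_const measurable_id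
  rw [gaussianReal_of_var_ne_zero _ hR, ← withDensity_mul _ (measurable_gaussianPDF _ _) hm,
    gaussianReal_of_var_ne_zero _ one_ne_zero]
  congr 1
  ext y
  exact ENNReal.mul_div_cancel (gaussianPDF_pos 0 hR y).ne' gaussianPDF_ne_top

/-- The vector with entries one on `S` and zero elsewhere. -/
def indicatorVector {p : ℕ} (S : Finset (Fin p)) : Fin p → ℝ := fun j ↦ if j ∈ S then 1 else 0

lemma indicatorVector_mem_sparseVectors {p : ℕ} (S : Finset (Fin p)) :
    indicatorVector S ∈ sparseVectors S.card p := by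
  have : Function.support (indicatorVector S) = S := by
    ext j; simp [indicatorVector]
  simp [sparseVectors, this]

lemma mulVec_indicatorVector {n p : ℕ} (X : Matrix (Fin n) (Fin p) ℝ) (S : Finset (Fin p))
    (i : Fin n) : X.mulVec (indicatorVector S) i = ∑ j ∈ S, X i j := by
  simp [Matrix.mulVec, dotProduct, indicatorVector]

/-- The likelihood ratio of `N(X 1_S, I)` with respect to `N(0, R I)`. -/
noncomputable def likelihoodRatio {n p : ℕ} (R : ℝ≥0) (S : Finset (Fin p)) (X : Fin n → Fin p → ℝ)
    (y : Fin n → ℝ) : ℝ≥0∞ :=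
  ∏ i, gaussianRatio R (∑ j ∈ S, X i j) (y i)

lemma measurable_likelihoodRatio {n p : ℕ} (R : ℝ≥0) (S : Finset (Fin p)) :
    Measurable fun z : (Fin n → Fin p → ℝ) × (Fin n → ℝ) ↦ likelihoodRatio R S z.1 z.2 := by
  refine Finset.measurable_prod _ fun i _ ↦ measurable_gaussianRatio_comp R ?_ ?_
  · exact Finset.measurable_sum _ fun j _ ↦ by fun_prop
  · fun_prop

lemma measurable_likelihoodRatio_right {n p : ℕ} (R : ℝ≥0) (S : Finset (Fin p))
    (X : Fin n → Fin p → ℝ) : Measurable fun y ↦ likelihoodRatio R S X y :=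
  Finset.measurable_prod _ fun i _ ↦
    measurable_gaussianRatio_comp R measurable_const (measurable_pi_apply i)

lemma responseLaw_indicatorVector {n p : ℕ} {R : ℝ≥0} (hR : R ≠ 0) (S : Finset (Fin p))
    (X : Matrix (Fin n) (Fin p) ℝ) :
    responseLaw X (indicatorVector S) 1 =
      (Measure.pi fun _ : Fin n ↦ gaussianReal 0 R).withDensity (likelihoodRatio R S X) := by
  have hs : ∀ u, SigmaFinite ((gaussianReal 0 R).withDensity (gaussianRatio R u)) := fun u ↦ by
    rw [gaussianReal_withDensity_gaussianRatio hR]; infer_instance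
  have h := pi_withDensity_prod (fun _ : Fin n ↦ gaussianReal 0 R)
    (f := fun i ↦ gaussianRatio R (∑ j ∈ S, X i j))
    (fun i ↦ measurable_gaussianRatio_comp R measurable_const measurable_id)
  simp_rw [gaussianReal_withDensity_gaussianRatio hR] at h
  simp only [responseLaw, mulVec_indicatorVector, one_pow, Real.toNNReal_one]
  exact h

lemma lintegral_likelihoodRatio_mul {n p : ℕ} (s : ℝ≥0) {S T : Finset (Fin p)}
    (hST : S.card = T.card) :
    ∫⁻ X, ∫⁻ y, likelihoodRatio (1 + S.card * s) S X y * likelihoodRatio (1 + S.card * s) T X y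
        ∂(Measure.pi fun _ : Fin n ↦ gaussianReal 0 (1 + S.card * s))
        ∂(Measure.pi fun _ : Fin n ↦ Measure.pi fun _ : Fin p ↦ gaussianReal 0 s) =
      ENNReal.ofReal ((1 + S.card * s) / (1 + (S \ T).card * s)) ^ n := by
  set R : ℝ≥0 := 1 + S.card * s
  have hm : Measurable fun z : (Fin p → ℝ) × ℝ ↦
      gaussianRatio R (∑ j ∈ S, z.1 j) z.2 * gaussianRatio R (∑ j ∈ T, z.1 j) z.2 := by
    refine (measurable_gaussianRatio_comp R ?_ measurable_snd).mul
      (measurable_gaussianRatio_comp R ?_ measurable_snd) <;>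
    exact Finset.measurable_sum _ fun j _ ↦ by fun_prop
  simp_rw [likelihoodRatio, ← Finset.prod_mul_distrib]
  have h1 : ∀ X : Fin n → Fin p → ℝ, ∫⁻ y, ∏ i, (gaussianRatio R (∑ j ∈ S, X i j) (y i) *
      gaussianRatio R (∑ j ∈ T, X i j) (y i)) ∂(Measure.pi fun _ : Fin n ↦ gaussianReal 0 R) =
      ∏ i, ∫⁻ y, gaussianRatio R (∑ j ∈ S, X i j) y * gaussianRatio R (∑ j ∈ T, X i j) y
        ∂(gaussianReal 0 R) := fun X ↦
    lintegral_pi_prod_eq (fun _ : Fin n ↦ gaussianReal 0 R)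
      (f := fun i y ↦ gaussianRatio R (∑ j ∈ S, X i j) y * gaussianRatio R (∑ j ∈ T, X i j) y)
      fun i ↦ by
        have h := hm.comp (measurable_prodMk_left (x := X i))
        exact h
  simp_rw [h1]
  rw [lintegral_pi_prod_eq (fun _ : Fin n ↦ Measure.pi fun _ : Fin p ↦ gaussianReal 0 s)
    (f := fun _ x ↦ ∫⁻ y, gaussianRatio R (∑ j ∈ S, x j) y * gaussianRatio R (∑ j ∈ T, x j) y
        ∂(gaussianReal 0 R)) fun i ↦ hm.lintegral_prod_right', Finset.prod_const,
    Finset.card_univ, Fintype.card_fin, lintegral_gaussianRatio_mul s hST]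

/-- The likelihood ratio of the uniform mixture of the laws `N(X 1_{S f}, I)`. -/
noncomputable def mixtureRatio {n p : ℕ} {κ : Type*} [Fintype κ] (R : ℝ≥0) (S : κ → Finset (Fin p))
    (X : Fin n → Fin p → ℝ) (y : Fin n → ℝ) : ℝ≥0∞ :=
  (Fintype.card κ : ℝ≥0∞)⁻¹ * ∑ f, likelihoodRatio R (S f) X y

lemma measurable_mixtureRatio {n p : ℕ} {κ : Type*} [Fintype κ] (R : ℝ≥0)
    (S : κ → Finset (Fin p)) :
    Measurable fun z : (Fin n → Fin p → ℝ) × (Fin n → ℝ) ↦ mixtureRatio R S z.1 z.2 :=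
  (Finset.measurable_sum _ fun f _ ↦ measurable_likelihoodRatio R (S f)).const_mul _

lemma measurable_mixtureRatio_right {n p : ℕ} {κ : Type*} [Fintype κ] (R : ℝ≥0)
    (S : κ → Finset (Fin p)) (X : Fin n → Fin p → ℝ) : Measurable fun y ↦ mixtureRatio R S X y :=
  (Finset.measurable_sum _ fun f _ ↦ measurable_likelihoodRatio_right R (S f) X).const_mul _

/-- Expanding the square gives a sum over pairs of supports, and independence of the rows gives the
power `n`. -/
lemma lintegral_mixtureRatio_sq {n p k : ℕ} {κ : Type*} [Fintype κ] (s : ℝ≥0)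
    {S : κ → Finset (Fin p)} (hS : ∀ f, (S f).card = k) :
    ∫⁻ X, ∫⁻ y, mixtureRatio (1 + k * s) S X y ^ 2
        ∂(Measure.pi fun _ : Fin n ↦ gaussianReal 0 (1 + k * s))
        ∂(Measure.pi fun _ : Fin n ↦ Measure.pi fun _ : Fin p ↦ gaussianReal 0 s) =
      (Fintype.card κ : ℝ≥0∞)⁻¹ ^ 2 *
        ∑ f, ∑ g, ENNReal.ofReal ((1 + k * s) / (1 + (S f \ S g).card * s)) ^ n := by
  set R : ℝ≥0 := 1 + k * s with hR
  have hm : ∀ f g, Measurable fun z : (Fin n → Fin p → ℝ) × (Fin n → ℝ) ↦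
      likelihoodRatio R (S f) z.1 z.2 * likelihoodRatio R (S g) z.1 z.2 := fun f g ↦
    (measurable_likelihoodRatio R (S f)).mul (measurable_likelihoodRatio R (S g))
  have hm1 : ∀ f g (X : Fin n → Fin p → ℝ), Measurable fun y ↦
      likelihoodRatio R (S f) X y * likelihoodRatio R (S g) X y := fun f g X ↦
    (measurable_likelihoodRatio_right R (S f) X).mul (measurable_likelihoodRatio_right R (S g) X)
  have h1 : ∀ X : Fin n → Fin p → ℝ, ∫⁻ y, mixtureRatio R S X y ^ 2
      ∂(Measure.pi fun _ : Fin n ↦ gaussianReal 0 R) = (Fintype.card κ : ℝ≥0∞)⁻¹ ^ 2 *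
        ∑ f, ∑ g, ∫⁻ y, likelihoodRatio R (S f) X y * likelihoodRatio R (S g) X y
          ∂(Measure.pi fun _ : Fin n ↦ gaussianReal 0 R) := by
    intro X
    simp_rw [mixtureRatio, mul_pow, pow_two (∑ f, _), Finset.sum_mul_sum]
    rw [lintegral_const_mul _ (Finset.measurable_sum _ fun f _ ↦ Finset.measurable_sum _
      fun g _ ↦ hm1 f g X), lintegral_finsetSum _ fun f _ ↦ Finset.measurable_sum _
      fun g _ ↦ hm1 f g X]
    congr 1
    exact Finset.sum_congr rfl fun f _ ↦ lintegral_finsetSum _ fun g _ ↦ hm1 f g X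
  have hm2 : ∀ f g, Measurable fun X : Fin n → Fin p → ℝ ↦
      ∫⁻ y, likelihoodRatio R (S f) X y * likelihoodRatio R (S g) X y
          ∂(Measure.pi fun _ : Fin n ↦ gaussianReal 0 R) := fun f g ↦
    (hm f g).lintegral_prod_right'
  simp_rw [h1]
  rw [lintegral_const_mul _ (Finset.measurable_sum _ fun f _ ↦ Finset.measurable_sum _
    fun g _ ↦ hm2 f g), lintegral_finsetSum _ fun f _ ↦ Finset.measurable_sum _
    fun g _ ↦ hm2 f g]
  congr 1
  refine Finset.sum_congr rfl fun f _ ↦ ?_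
  rw [lintegral_finsetSum _ fun g _ ↦ hm2 f g]
  refine Finset.sum_congr rfl fun g _ ↦ ?_
  have h := lintegral_likelihoodRatio_mul (n := n) s ((hS f).trans (hS g).symm)
  rwa [hS f] at h

/-! ### Block supports and the choice of the design. -/

/-- The support with one column chosen in each of `k` blocks of size `q`. -/
def blockSupport {k q p : ℕ} (e : Fin k × Fin q ↪ Fin p) (f : Fin k → Fin q) : Finset (Fin p) :=
  Finset.univ.map ⟨fun i ↦ e (i, f i), fun _ _ h ↦ (Prod.ext_iff.1 (e.injective h)).1⟩

lemma card_blockSupport {k q p : ℕ} (e : Fin k × Fin q ↪ Fin p) (f : Fin k → Fin q) :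
    (blockSupport e f).card = k := by
  simp [blockSupport]

lemma card_blockSupport_sdiff {k q p : ℕ} (e : Fin k × Fin q ↪ Fin p) (f g : Fin k → Fin q) :
    (blockSupport e f \ blockSupport e g).card + (Finset.univ.filter fun i ↦ f i = g i).card = k := by
  have h : blockSupport e f ∩ blockSupport e g = (Finset.univ.filter fun i ↦ f i = g i).map
      ⟨fun i ↦ e (i, f i), fun _ _ h ↦ (Prod.ext_iff.1 (e.injective h)).1⟩ := by
    ext j
    simp only [blockSupport, Finset.mem_inter, Finset.mem_map, Finset.mem_univ, true_and,
      Finset.mem_filter]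
    constructor
    · rintro ⟨⟨a, rfl⟩, b, hb⟩
      have h := Prod.ext_iff.1 (e.injective hb)
      obtain rfl : b = a := h.1
      exact ⟨b, h.2.symm, rfl⟩
    · rintro ⟨a, ha, rfl⟩
      exact ⟨⟨a, rfl⟩, a, show e (a, g a) = e (a, f a) by rw [ha]⟩
  have h2 := Finset.card_sdiff_add_card_inter (blockSupport e f) (blockSupport e g)
  rwa [h, Finset.card_map, card_blockSupport] at h2

/-- The sum factors over the blocks: in each, one choice agrees with `f` and the `q - 1` others do
not. -/
lemma sum_pow_card_filter_eq {k q : ℕ} (a : ℝ) (f : Fin k → Fin q) :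
    ∑ g : Fin k → Fin q, a ^ (Finset.univ.filter fun i ↦ f i = g i).card =
      (a + (q - 1)) ^ k := by
  have h1 : ∀ g : Fin k → Fin q, a ^ (Finset.univ.filter fun i ↦ f i = g i).card =
      ∏ i, if f i = g i then a else 1 := by
    intro g
    rw [Finset.prod_ite]
    simp
  simp_rw [h1]
  rw [← Fintype.prod_sum fun i j ↦ if f i = j then a else 1]
  have h2 : ∀ i, ∑ j, (if f i = j then a else 1) = a + (q - 1) := by
    intro i
    have : ∀ j, (if f i = j then a else 1) = (if f i = j then a - 1 else 0) + 1 := by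
      intro j; split_ifs <;> ring
    simp_rw [this, Finset.sum_add_distrib]
    simp
    ring
  simp [h2]

/-- Weighted arithmetic-geometric mean bound for a ratio of variances. -/
lemma variance_ratio_le_rpow {R t : ℝ} (hR : 1 ≤ R) (ht0 : 0 ≤ t) (ht1 : t ≤ 1) :
    R / (1 + (1 - t) * (R - 1)) ≤ R ^ t := by
  have hR0 : 0 < R := by linarith
  have h := Real.geom_mean_le_arith_mean2_weighted (w₁ := 1 - t) (w₂ := t) (p₁ := R) (p₂ := 1)
    (by linarith) ht0 hR0.le zero_le_one (by ring)
  rw [Real.one_rpow, mul_one, mul_one, Real.rpow_sub hR0, Real.rpow_one,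
    div_le_iff₀ (by positivity)] at h
  rw [div_le_iff₀ (by nlinarith [mul_nonneg (sub_nonneg.2 ht1) (sub_nonneg.2 hR)])]
  linarith

/-- A probabilistic choice: some design does no worse than the Gaussian average, which is computed
by overlap counts. -/
lemma exists_design {n p k q : ℕ} (hk : 1 ≤ k) (hq : 1 ≤ q) (hkq : k * q ≤ p) {R : ℝ≥0}
    (hR : 1 ≤ R) {a : ℝ} (ha : 0 ≤ a) (hak : (R : ℝ) ^ n = a ^ k) :
    ∃ (X : Fin n → Fin p → ℝ) (S : (Fin k → Fin q) → Finset (Fin p)), (∀ f, (S f).card = k) ∧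
      ∫⁻ y, mixtureRatio R S X y ^ 2 ∂(Measure.pi fun _ : Fin n ↦ gaussianReal 0 R) ≤
        ENNReal.ofReal (Real.exp (k * (a / q))) := by
  have hk0 : (0 : ℝ) < k := by exact_mod_cast hk
  have hq0 : (0 : ℝ) < q := by exact_mod_cast hq
  have hR1 : (1 : ℝ) ≤ R := by exact_mod_cast hR
  obtain ⟨e⟩ : Nonempty (Fin k × Fin q ↪ Fin p) :=
    Function.Embedding.nonempty_of_card_le (by simpa using hkq)
  -- Entry variance for which `k` columns add `R - 1` to the unit noise.
  set s : ℝ≥0 := (R - 1) / k with hs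
  have hks : 1 + (k : ℝ≥0) * s = R := by
    rw [hs, mul_div_cancel₀ _ (by positivity), add_tsub_cancel_of_le hR]
  have hsR : (s : ℝ) = (R - 1) / k := by
    rw [hs]; push_cast [NNReal.coe_sub hR]; rfl
  have hks' : 1 + (k : ℝ) * s = R := by rw [← hks]; push_cast; rfl
  set S := blockSupport e
  have hm : Measurable fun X : Fin n → Fin p → ℝ ↦
      ∫⁻ y, mixtureRatio R S X y ^ 2 ∂(Measure.pi fun _ : Fin n ↦ gaussianReal 0 R) :=
    ((measurable_mixtureRatio R S).pow_const 2).lintegral_prod_right'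
  obtain ⟨X, hX⟩ := exists_le_lintegral
    (μ := Measure.pi fun _ : Fin n ↦ Measure.pi fun _ : Fin p ↦ gaussianReal 0 s) hm.aemeasurable
  refine ⟨X, S, card_blockSupport e, hX.trans ?_⟩
  have h := lintegral_mixtureRatio_sq (n := n) s (S := S) (card_blockSupport e)
  rw [hks, hks'] at h
  rw [h]
  have hbound : ∀ f g, ENNReal.ofReal (R / (1 + (S f \ S g).card * s)) ^ n ≤
      ENNReal.ofReal (a ^ (Finset.univ.filter fun i ↦ f i = g i).card) := by
    intro f g
    set m := (Finset.univ.filter fun i ↦ f i = g i).card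
    have hm : ((S f \ S g).card : ℝ) + m = k := by exact_mod_cast card_blockSupport_sdiff e f g
    have hmk : (m : ℝ) ≤ k := by have := (S f \ S g).card.cast_nonneg (α := ℝ); linarith
    have hV : 1 + ((S f \ S g).card : ℝ) * s = 1 + (1 - m / k) * (R - 1) := by
      rw [hsR, eq_sub_of_add_eq hm]; field_simp
    have hle := variance_ratio_le_rpow hR1 (t := m / k) (by positivity) ((div_le_one hk0).2 hmk)
    rw [← ENNReal.ofReal_pow (by positivity), hV]
    refine ENNReal.ofReal_le_ofReal ?_
    have h0 : 0 ≤ (R : ℝ) / (1 + (1 - m / k) * (R - 1)) := by rw [← hV]; positivity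
    refine (pow_le_pow_left₀ h0 hle n).trans_eq ?_
    rw [← Real.rpow_natCast, ← Real.rpow_mul (by positivity), mul_comm, Real.rpow_mul (by positivity),
      Real.rpow_natCast, hak, ← Real.rpow_natCast a k, ← Real.rpow_mul ha,
      mul_div_cancel₀ _ hk0.ne', Real.rpow_natCast]
  calc _ ≤ (Fintype.card (Fin k → Fin q) : ℝ≥0∞)⁻¹ ^ 2 * ∑ f : Fin k → Fin q,
        ∑ g : Fin k → Fin q,
        ENNReal.ofReal (a ^ (Finset.univ.filter fun i ↦ f i = g i).card) := by
        gcongr; exact hbound _ _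
    _ = ENNReal.ofReal (((a + (q - 1)) / q) ^ k) := by
        have : ∀ f : Fin k → Fin q, ∑ g : Fin k → Fin q,
            ENNReal.ofReal (a ^ (Finset.univ.filter fun i ↦ f i = g i).card) =
            ENNReal.ofReal ((a + (q - 1)) ^ k) := fun f ↦ by
          rw [← ENNReal.ofReal_sum_of_nonneg (fun _ _ ↦ by positivity), sum_pow_card_filter_eq]
        simp_rw [this]
        have hN : (Fintype.card (Fin k → Fin q) : ℝ≥0∞) = ENNReal.ofReal ((q : ℝ) ^ k) := by
          simp [ENNReal.ofReal_pow]
        have h1 : 0 ≤ a + (q - 1 : ℝ) := by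
          have : (1 : ℝ) ≤ q := by exact_mod_cast hq
          linarith
        rw [Finset.sum_const, Finset.card_univ, nsmul_eq_mul, hN,
          ← ENNReal.ofReal_inv_of_pos (by positivity), ← ENNReal.ofReal_pow (by positivity),
          ← ENNReal.ofReal_mul (by positivity), ← ENNReal.ofReal_mul (by positivity)]
        congr 1
        rw [div_pow]
        field_simp
    _ ≤ _ := by
        refine ENNReal.ofReal_le_ofReal ?_
        rw [Real.exp_nat_mul]
        have h1 : (1 : ℝ) ≤ q := by exact_mod_cast hq
        refine pow_le_pow_left₀ (div_nonneg (by linarith) hq0.le) ?_ k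
        have h2 := Real.add_one_le_exp (a / q)
        refine le_trans ?_ h2
        rw [div_le_iff₀ hq0, add_mul, div_mul_cancel₀ _ hq0.ne']
        linarith

/-! ### Le Cam's testing bound and the variance loss. -/

lemma half_le_measure_compl_add {α : Type*} [MeasurableSpace α] {γ : Measure α}
    [IsProbabilityMeasure γ] {L : α → ℝ≥0∞} (hL : Measurable L) (h1 : ∫⁻ y, L y ∂γ = 1)
    (h2 : ∫⁻ y, L y ^ 2 ∂γ ≤ 2) {A : Set α} (hA : MeasurableSet A) :
    2⁻¹ ≤ γ Aᶜ + ∫⁻ y in A, L y ∂γ := by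
  -- This is `(x - 2) ^ 2 ≥ 0`; the weight `4⁻¹` turns the second moment bound 2 into `2⁻¹`.
  have hpt : ∀ x : ℝ≥0∞, x ≤ 4⁻¹ * x ^ 2 + 1 := by
    intro x
    rcases eq_or_ne x ⊤ with rfl | hx
    · rw [ENNReal.top_pow two_ne_zero, ENNReal.mul_top (by simp)]; simp
    · lift x to ℝ≥0 using hx
      have : x ≤ 4⁻¹ * x ^ 2 + 1 := by
        rw [← NNReal.coe_le_coe]; push_cast; nlinarith [sq_nonneg ((x : ℝ) - 2)]
      have h := ENNReal.coe_le_coe.2 this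
      rwa [ENNReal.coe_add, ENNReal.coe_mul, ENNReal.coe_inv (by norm_num), ENNReal.coe_pow] at h
  have h3 : ∫⁻ y in Aᶜ, L y ∂γ ≤ 2⁻¹ + γ Aᶜ := by
    calc _ ≤ ∫⁻ y in Aᶜ, (4⁻¹ * L y ^ 2 + 1) ∂γ := lintegral_mono fun y ↦ hpt _
      _ = 4⁻¹ * ∫⁻ y in Aᶜ, L y ^ 2 ∂γ + γ Aᶜ := by
        rw [lintegral_add_right _ measurable_const, lintegral_const_mul _ (hL.pow_const 2)]
        simp
      _ ≤ 4⁻¹ * 2 + γ Aᶜ := by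
        gcongr
        exact (setLIntegral_le_lintegral _ _).trans h2
      _ = 2⁻¹ + γ Aᶜ := by
        congr 1
        rw [show (4 : ℝ≥0∞) = 2 * 2 by norm_num, ENNReal.mul_inv (by simp) (by simp), mul_assoc,
          ENNReal.inv_mul_cancel (by simp) (by simp), mul_one]
  have h4 := lintegral_add_compl L hA (μ := γ)
  rw [h1] at h4
  have h5 : (2⁻¹ : ℝ≥0∞) + 2⁻¹ ≤ 2⁻¹ + (γ Aᶜ + ∫⁻ y in A, L y ∂γ) := by
    rw [ENNReal.inv_two_add_inv_two, ← h4, add_comm, ← add_assoc]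
    gcongr
  exact (ENNReal.add_le_add_iff_left (by simp)).1 h5

lemma lintegral_mixtureRatio {n p : ℕ} {κ : Type*} [Fintype κ] [Nonempty κ] {R : ℝ≥0} (hR : R ≠ 0)
    (S : κ → Finset (Fin p)) (X : Fin n → Fin p → ℝ) (A : Set (Fin n → ℝ)) (hA : MeasurableSet A) :
    ∫⁻ y in A, mixtureRatio R S X y ∂(Measure.pi fun _ : Fin n ↦ gaussianReal 0 R) =
      (Fintype.card κ : ℝ≥0∞)⁻¹ * ∑ f, responseLaw (Matrix.of X) (indicatorVector (S f)) 1 A := by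
  simp_rw [mixtureRatio]
  rw [lintegral_const_mul _ (Finset.measurable_sum _ fun f _ ↦
      measurable_likelihoodRatio_right R (S f) X), lintegral_finsetSum _ fun f _ ↦
      measurable_likelihoodRatio_right R (S f) X]
  congr 1
  refine Finset.sum_congr rfl fun f _ ↦ ?_
  rw [responseLaw_indicatorVector hR, withDensity_apply _ hA]
  rfl

instance isProbabilityMeasure_responseLaw {n p : ℕ} (X : Matrix (Fin n) (Fin p) ℝ) (θ : Fin p → ℝ)
    (σ : ℝ) : IsProbabilityMeasure (responseLaw X θ σ) := by
  unfold responseLaw; infer_instance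

lemma responseLaw_zero {n p : ℕ} (X : Matrix (Fin n) (Fin p) ℝ) (R : ℝ≥0) :
    responseLaw X 0 (√R) = Measure.pi fun _ : Fin n ↦ gaussianReal 0 R := by
  simp [responseLaw]

lemma mul_measure_le_varianceRisk {n p : ℕ} (X : Matrix (Fin n) (Fin p) ℝ)
    (σhat : (Fin n → ℝ) → ℝ≥0) (θ : Fin p → ℝ) (σ : ℝ) {D : ℝ≥0∞} {A : Set (Fin n → ℝ)}
    (hA : MeasurableSet A) (h : ∀ y ∈ A, D ≤ varianceLoss (σhat y) σ) :
    D * responseLaw X θ σ A ≤ varianceRisk X σhat θ σ := by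
  rw [varianceRisk, ← setLIntegral_const]
  exact (setLIntegral_mono' hA h).trans (setLIntegral_le_lintegral _ _)

/-- The threshold `r` is the geometric mean of the variances `1` and `r ^ 2`, so both kinds of error
cost at least `r - 1 / r`. -/
lemma le_varianceLoss_one {r : ℝ} (hr : 0 < r) {s : ℝ≥0} (hs : r ≤ (s : ℝ) ^ 2) :
    ENNReal.ofReal (r - 1 / r) ≤ varianceLoss s 1 := by
  unfold varianceLoss
  split_ifs with h
  · exact le_top
  refine ENNReal.ofReal_le_ofReal (le_trans ?_ (le_abs_self _))
  rw [one_pow, div_one]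
  have := one_div_le_one_div_of_le hr hs
  linarith

lemma le_varianceLoss_of_lt {r : ℝ} (hr : 0 < r) {s : ℝ≥0} (hs : (s : ℝ) ^ 2 < r) :
    ENNReal.ofReal (r - 1 / r) ≤ varianceLoss s r := by
  unfold varianceLoss
  split_ifs with h
  · exact le_top
  have hs0 : (0 : ℝ) < s ^ 2 := by positivity
  refine ENNReal.ofReal_le_ofReal (le_trans ?_ (neg_le_abs _))
  have h1 : r ≤ r ^ 2 / s ^ 2 := by
    rw [le_div_iff₀ hs0, pow_two r]; gcongr
  have h2 : (s : ℝ) ^ 2 / r ^ 2 ≤ 1 / r := by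
    rw [div_le_div_iff₀ (by positivity) hr, one_mul, pow_two r]; gcongr
  linarith

/-- Le Cam's two-point bound for the variance: the null is `N(0, r² I)`, the alternative a mixture
of sparse regressions with unit variance. -/
lemma le_minimaxVarianceRisk {n p k : ℕ} {κ : Type*} [Fintype κ] [Nonempty κ] {r : ℝ≥0}
    (hr : r ≠ 0) {S : κ → Finset (Fin p)} (hS : ∀ f, (S f).card = k) (X : Fin n → Fin p → ℝ)
    (h2 : ∫⁻ y, mixtureRatio (r ^ 2) S X y ^ 2
      ∂(Measure.pi fun _ : Fin n ↦ gaussianReal 0 (r ^ 2)) ≤ 2) :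
    ENNReal.ofReal ((r - 1 / r : ℝ) / 4) ≤ minimaxVarianceRisk k (Matrix.of X) := by
  have hr0 : (0 : ℝ) < r := by positivity
  have hr2 : r ^ 2 ≠ 0 := by positivity
  have hN0 : (Fintype.card κ : ℝ≥0∞) ≠ 0 := by simp
  refine le_iInf₂ fun σhat hσ ↦ ?_
  set M := ⨆ (σ : ℝ) (_ : 0 < σ) (θ : Fin p → ℝ) (_ : θ ∈ sparseVectors k p),
      varianceRisk (Matrix.of X) σhat θ σ with hM
  have hle : ∀ σ : ℝ, 0 < σ → ∀ θ ∈ sparseVectors k p,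
      varianceRisk (Matrix.of X) σhat θ σ ≤ M := fun σ h θ hθ ↦
    le_iSup₂_of_le σ h (le_iSup₂_of_le θ hθ le_rfl)
  set D := ENNReal.ofReal (r - 1 / r : ℝ) with hD
  set A : Set (Fin n → ℝ) := {y | (r : ℝ) ≤ (σhat y : ℝ) ^ 2} with hAdef
  have hA : MeasurableSet A := measurableSet_le measurable_const (by fun_prop)
  set γ := Measure.pi fun _ : Fin n ↦ gaussianReal 0 (r ^ 2)
  have h0 : D * γ Aᶜ ≤ M := by
    have h := mul_measure_le_varianceRisk (Matrix.of X) σhat 0 r (D := D) hA.compl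
      fun y hy ↦ le_varianceLoss_of_lt hr0 (not_le.1 hy)
    have e := responseLaw_zero (Matrix.of X) (r ^ 2)
    rw [NNReal.coe_pow, Real.sqrt_sq hr0.le] at e
    rw [e] at h
    exact h.trans (hle r hr0 0 (by simp [sparseVectors]))
  have hmean : ∀ c : ℝ≥0∞, (Fintype.card κ : ℝ≥0∞)⁻¹ * ∑ _f : κ, c = c := fun c ↦ by
    rw [Finset.sum_const, Finset.card_univ, nsmul_eq_mul, ← mul_assoc,
      ENNReal.inv_mul_cancel hN0 (by simp), one_mul]
  have h1 : D * ∫⁻ y in A, mixtureRatio (r ^ 2) S X y ∂γ ≤ M := by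
    rw [lintegral_mixtureRatio hr2 S X A hA, mul_left_comm, Finset.mul_sum]
    refine le_trans ?_ (hmean M).le
    gcongr with f
    refine (mul_measure_le_varianceRisk (Matrix.of X) σhat _ 1 hA
      fun y hy ↦ le_varianceLoss_one hr0 hy).trans (hle 1 one_pos _ ?_)
    rw [← hS f]
    exact indicatorVector_mem_sparseVectors _
  have hone : ∫⁻ y, mixtureRatio (r ^ 2) S X y ∂γ = 1 := by
    rw [← setLIntegral_univ, lintegral_mixtureRatio hr2 S X _ MeasurableSet.univ]
    simp_rw [measure_univ]
    exact hmean 1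
  have hhalf := half_le_measure_compl_add (measurable_mixtureRatio_right (r ^ 2) S X) hone h2 hA
  have h3 : D * 2⁻¹ ≤ 2 * M := by
    calc D * 2⁻¹ ≤ D * (γ Aᶜ + ∫⁻ y in A, mixtureRatio (r ^ 2) S X y ∂γ) := by gcongr
      _ ≤ M + M := by rw [mul_add]; exact add_le_add h0 h1
      _ = 2 * M := (two_mul M).symm
  have h4 : ENNReal.ofReal ((r - 1 / r : ℝ) / 4) = 2⁻¹ * (D * 2⁻¹) := by
    rw [hD, show (r - 1 / r : ℝ) / 4 = (r - 1 / r : ℝ) / 2 / 2 by ring,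
      ENNReal.ofReal_div_of_pos two_pos, ENNReal.ofReal_div_of_pos two_pos, ENNReal.ofReal_ofNat,
      div_eq_mul_inv, div_eq_mul_inv, mul_comm]
  rw [h4]
  calc _ ≤ 2⁻¹ * (2 * M) := by gcongr
    _ = M := by rw [← mul_assoc, ENNReal.inv_mul_cancel (by simp) (by simp), one_mul]

/-! ### Numerical estimates and conclusion. -/

lemma mul_exp_le_exp_sub_exp_neg {x : ℝ} (hx : 0 ≤ x) :
    x * Real.exp x ≤ Real.exp (2 * x) - 1 / Real.exp (2 * x) := by
  have h1 := Real.add_one_le_exp x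
  have h2 : Real.exp (2 * x) = Real.exp x * Real.exp x := by rw [← Real.exp_add, two_mul]
  have h3 : 1 / Real.exp (2 * x) ≤ 1 := by
    rw [div_le_one (Real.exp_pos _)]; exact Real.one_le_exp (by linarith)
  rw [h2] at h3 ⊢
  nlinarith [Real.one_le_exp hx]

/-- The left side is at most `2 * k ^ 2 * p ^ (1 / 6) / p ≤ 2 * p ^ (-1 / 6)`, where the 2 pays for
the floor in `p / k`; and `4096 = 4 ^ 6`. -/
lemma mul_rpow_div_le_half {p k : ℕ} (hp : 4096 ≤ p) (hk : 1 ≤ k)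
    (hkp : (k : ℝ) ≤ (p : ℝ) ^ (1 / 3 : ℝ)) :
    (k : ℝ) * (((p : ℝ) / k) ^ (1 / 6 : ℝ) / (p / k : ℕ)) ≤ 1 / 2 := by
  have hk0 : (1 : ℝ) ≤ k := by exact_mod_cast hk
  have hp1 : (4096 : ℝ) ≤ p := by exact_mod_cast hp
  have hp0 : (0 : ℝ) < p := by linarith
  have hkp' : k ≤ p := by
    have : (p : ℝ) ^ (1 / 3 : ℝ) ≤ p :=
      Real.rpow_le_self_of_one_le (by linarith) (by norm_num)
    exact_mod_cast hkp.trans this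
  have hq1 : 1 ≤ p / k := (Nat.one_le_div_iff (by omega)).2 hkp'
  have hq : (p : ℝ) ≤ 2 * k * (p / k : ℕ) := by
    have h := (Nat.lt_mul_div_succ p (show 0 < k by omega)).le
    have : p ≤ 2 * k * (p / k) := by nlinarith
    exact_mod_cast this
  have hq0 : (0 : ℝ) < (p / k : ℕ) := by exact_mod_cast hq1
  have ha : ((p : ℝ) / k) ^ (1 / 6 : ℝ) ≤ (p : ℝ) ^ (1 / 6 : ℝ) :=
    Real.rpow_le_rpow (by positivity) (div_le_self hp0.le hk0) (by norm_num)
  have h4 : (4 : ℝ) ≤ (p : ℝ) ^ (1 / 6 : ℝ) := by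
    have h := Real.rpow_le_rpow (by norm_num) hp1 (show (0 : ℝ) ≤ 1 / 6 by norm_num)
    rwa [show (4096 : ℝ) = 4 ^ (6 : ℝ) by norm_num, ← Real.rpow_mul (by norm_num),
      mul_one_div_cancel (by norm_num), Real.rpow_one] at h
  set b := (p : ℝ) ^ (1 / 6 : ℝ) with hb
  have hb3 : (p : ℝ) ^ (1 / 3 : ℝ) = b ^ 2 := by
    rw [hb, ← Real.rpow_natCast, ← Real.rpow_mul hp0.le]; norm_num
  have hb6 : (p : ℝ) = b ^ 6 := by
    rw [hb, ← Real.rpow_natCast, ← Real.rpow_mul hp0.le]; norm_num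
  rw [hb3] at hkp
  rw [← mul_div_assoc, div_le_iff₀ hq0]
  have hb0 : 0 < b := by linarith
  have h1 : 4 * ((k : ℝ) * k * b) ≤ p := by
    calc 4 * ((k : ℝ) * k * b) ≤ b * (b ^ 2 * b ^ 2 * b) := by gcongr
      _ = p := by rw [hb6]; ring
  have h2 : (k : ℝ) * (4 * (k * b)) ≤ k * (2 * (p / k : ℕ)) := by linarith
  have h3 := le_of_mul_le_mul_left h2 (by linarith)
  have h5 : (k : ℝ) * ((p : ℝ) / k) ^ (1 / 6 : ℝ) ≤ k * b := by gcongr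
  linarith

end SparseRegression

theorem mainTheorem12 :
    ∃ C C₁ C₂ : ℝ, 0 < C ∧ 0 < C₁ ∧ 0 < C₂ ∧
      ∀ n p k : ℕ, C ≤ (n : ℝ) → n ≤ p → 1 ≤ k → (k : ℝ) ≤ (p : ℝ) ^ (1 / 3 : ℝ) →
        ∃ X : Matrix (Fin n) (Fin p) ℝ,
          ENNReal.ofReal
              (C₁ * ((k : ℝ) / n) * Real.log ((p : ℝ) / k) *
                Real.exp (C₂ * ((k : ℝ) / n) * Real.log ((p : ℝ) / k))) ≤
            SparseRegression.minimaxVarianceRisk k X := by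
  refine ⟨4096, 1 / 96, 1 / 24, by norm_num, by norm_num, by norm_num, ?_⟩
  intro n p k hn hnp hk hkp
  have hn' : 4096 ≤ n := by exact_mod_cast hn
  have hp : 4096 ≤ p := hn'.trans hnp
  have hk0 : (0 : ℝ) < k := by exact_mod_cast hk
  have hn0 : (0 : ℝ) < n := by linarith
  have hp1 : (1 : ℝ) ≤ p := by exact_mod_cast (by omega : 1 ≤ p)
  have hkp' : (k : ℝ) ≤ p := hkp.trans (Real.rpow_le_self_of_one_le hp1 (by norm_num))
  have hq : 1 ≤ p / k := (Nat.one_le_div_iff (by omega)).2 (by exact_mod_cast hkp')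
  have hpk : 1 ≤ (p : ℝ) / k := (one_le_div hk0).2 hkp'
  have hpk0 : 0 < (p : ℝ) / k := by linarith
  have hlog : 0 ≤ Real.log ((p : ℝ) / k) := Real.log_nonneg hpk
  set ρ : ℝ := (k : ℝ) / n * Real.log ((p : ℝ) / k) with hρ
  have hρ0 : 0 ≤ ρ := by positivity
  -- Chosen so that `(r ^ 2) ^ n = exp (n * ρ / 6) = a ^ k`. With `x = ρ / 24`, the bound `(r - 1 /
  -- r) / 4 ≥ x * exp x / 4` gives the constants `1 / 96` and `1 / 24`.
  set r : ℝ≥0 := ⟨Real.exp (2 * (ρ / 24)), (Real.exp_pos _).le⟩ with hr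
  have hrc : (r : ℝ) = Real.exp (2 * (ρ / 24)) := rfl
  have hr1 : 1 ≤ r := by
    rw [← NNReal.coe_le_coe, hrc]; exact Real.one_le_exp (by positivity)
  have hak : ((r ^ 2 : ℝ≥0) : ℝ) ^ n = (((p : ℝ) / k) ^ (1 / 6 : ℝ)) ^ k := by
    rw [NNReal.coe_pow, hrc, Real.rpow_def_of_pos hpk0, ← Real.exp_nat_mul, ← Real.exp_nat_mul,
      ← Real.exp_nat_mul, hρ]
    congr 1
    push_cast
    field_simp
    ring
  obtain ⟨X, S, hS, hX⟩ := SparseRegression.exists_design (n := n) hk hq (Nat.mul_div_le p k)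
    (one_le_pow₀ hr1) (by positivity) hak
  have : Nonempty (Fin (p / k)) := ⟨⟨0, hq⟩⟩
  have hexp : Real.exp (k * (((p : ℝ) / k) ^ (1 / 6 : ℝ) / (p / k : ℕ))) ≤ 2 := by
    have h1 := SparseRegression.mul_rpow_div_le_half hp hk hkp
    refine (Real.exp_le_exp.2 h1).trans ?_
    have h2 : Real.exp (1 / 2) * Real.exp (1 / 2) = Real.exp 1 := by
      rw [← Real.exp_add]; norm_num
    nlinarith [Real.exp_one_lt_d9, Real.exp_pos (1 / 2)]
  refine ⟨Matrix.of X, le_trans ?_ (SparseRegression.le_minimaxVarianceRisk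
    (r := r) (by positivity) hS X (hX.trans ?_))⟩
  · refine ENNReal.ofReal_le_ofReal ?_
    have h := SparseRegression.mul_exp_le_exp_sub_exp_neg (x := ρ / 24) (by positivity)
    rw [hrc, mul_assoc (1 / 96 : ℝ), mul_assoc (1 / 24 : ℝ), ← hρ,
      show (1 / 24 : ℝ) * ρ = ρ / 24 by ring]
    linarith
  · rw [← ENNReal.ofReal_ofNat 2]
    exact ENNReal.ofReal_le_ofReal hexp
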